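/- Let $q=3^s$ with $s\ge 2$. Let $m$ be the multiplicative order of $q$ modulo $q+1$, let $\alpha$ be a generator of $\mathrm{GF}(q^m)^*$, and put $\beta=\alpha^{(q^m-1)/(q+1)}$, a primitive $(q+1)$-th root of unity. Let $\mathsf{C}=\mathsf{C}_{(q,q+1,3,1)}$ be the narrow-sense BCH code over $\mathrm{GF}(q)$ of length $q+1$ and designed distance $3$, that is, the cyclic code of length $q+1$ (identified, via $(c_0,\dots,c_q)\mapsto \sum_i c_ix^i$, with an ideal of $\mathrm{GF}(q)[x]/(x^{q+1}-1)$) whose generator polynomial is the least common multiple of the minimal polynomials of $\beta$ and $\beta^2$ over $\mathrm{GF}(q)$. Let $\mathsf{C}^\perp$ be its dual with respect to the standard bilinear form. An $[n,k,d]$ code is a linear code of length $n$, dimension $k$ and minimum Hamming distance $d$; it is almost MDS if $d=n-k$, and a code is near MDS (NMDS) if both it and its dual are almost MDS. The codewords of weight $w$ of a code of length $n$ are said to support a $t$-$(n,w,\lambda)$ design if every $t$-subset of the set of $n$ coordinate positions is contained in exactly $\lambda$ of the distinct supports of codewords of weight $w$. Then: 1. $\mathsf{C}$ is a $[q+1,q-3,4]$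 code and $\mathsf{C}^\perp$ is a $[q+1,4,q-3]$ code; both $\mathsf{C}$ and $\mathsf{C}^\perp$ are NMDS. 2. The weight enumerator $\sum_w A_w^\perp z^w$ of $\mathsf{C}^\perp$, where $A_w^\perp$ is the number of codewords of weight $w$ in $\mathsf{C}^\perp$, equals $$1+\frac{(q-1)^2q(q+1)}{24}z^{q-3}+\frac{(q-1)q(q+1)(q+3)}{4}z^{q-1}+\frac{(q^2-1)(q^2-q+3)}{3}z^{q}+\frac{3(q-1)^2q(q+1)}{8}z^{q+1}.$$ 3. The minimum-weight codewords (weight $q-3$) of $\mathsf{C}^\perp$ support a $3$-$\left(q+1,\,q-3,\,\frac{(q-3)(q-4)(q-5)}{24}\right)$ design. 4. The minimum-weight codewords (weight $4$) of $\mathsf{C}$ support a $3$-$(q+1,4,1)$ design, i.e. a Steiner quadruple system $S(3,4,3^s+1)$. 5. The codewords of weight $5$ of $\mathsf{C}$ support a $3$-$\left(q+1,\,5,\,\frac{(q-3)(q-7)}{2}\right)$ design. -/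

import Mathlib

open Polynomial

/-! ### Linear codes of length `n` over a field `F`: subspaces of `F ^ n` -/

section LinearCodes

variable {F : Type*} [Field F] {n : ℕ}

/-- The dual code with respect to the standard bilinear form `∑ i, x i * y i`. -/
def dualCode (C : Submodule F (Fin n → F)) : Submodule F (Fin n → F) :=
  Submodule.orthogonalBilin (dotProductBilin F F) C

variable [DecidableEq F]

/-- `C` is an `[n, k, d]` linear code: its dimension is `k`, and `d` is its minimum distance,
i.e. the least Hamming distance between two distinct codewords. -/
def HasParameters (C : Submodule F (Fin n → F)) (k d : ℕ) : Prop :=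
  Module.finrank F C = k ∧
    IsLeast {w : ℕ | ∃ x ∈ C, ∃ y ∈ C, x ≠ y ∧ hammingDist x y = w} d

/-- An almost MDS code: an `[n, k, d]` code whose Singleton defect `n - k + 1 - d` equals `1`. -/
def IsAMDS (C : Submodule F (Fin n → F)) : Prop :=
  ∃ k d : ℕ, HasParameters C k d ∧ (n : ℤ) - k + 1 - d = 1

/-- A near MDS code: the code and its dual are both almost MDS. -/
def IsNMDS (C : Submodule F (Fin n → F)) : Prop :=
  IsAMDS C ∧ IsAMDS (dualCode C)

/-- The number `A_w` of codewords of Hamming weight `w`. -/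
noncomputable def weightCount (C : Submodule F (Fin n → F)) (w : ℕ) : ℕ :=
  {c : Fin n → F | c ∈ C ∧ hammingNorm c = w}.ncard

/-- The weight enumerator `∑_{w = 0}^{n} A_w z ^ w`. -/
noncomputable def weightEnumerator (C : Submodule F (Fin n → F)) : ℚ[X] :=
  ∑ w ∈ Finset.range (n + 1), Polynomial.C (weightCount C w : ℚ) * X ^ w

/-- The support of a word: the set of its nonzero coordinate positions. -/
def wordSupport (c : Fin n → F) : Finset (Fin n) :=
  Finset.univ.filter fun i => c i ≠ 0

/-- The set of the supports of all codewords of Hamming weight `w`. -/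
def supportBlocks (C : Submodule F (Fin n → F)) (w : ℕ) : Set (Finset (Fin n)) :=
  {B | ∃ c ∈ C, hammingNorm c = w ∧ wordSupport c = B}

end LinearCodes

/-! ### Simple `t`-designs -/

/-- `(P, B)` is a (simple) `t`-`(v, k, l)` design: `P` is a set of `v` points, `B` is a set of
`k`-subsets of `P`, and every `t`-subset of `P` is contained in exactly `l` members of `B`. -/
structure IsDesign {P : Type*} [Fintype P] (B : Set (Finset P)) (t v k l : ℕ) : Prop where
  one_le_t : 1 ≤ t
  t_le_k : t ≤ k
  k_le_v : k ≤ v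
  card_points : Fintype.card P = v
  card_block : ∀ b ∈ B, b.card = k
  balanced : ∀ T : Finset P, T.card = t → {b | b ∈ B ∧ T ⊆ b}.ncard = l

/-- A Steiner system `S(t, k, v)`: a `t`-`(v, k, 1)` design with `t ≥ 2`. -/
def IsSteinerSystem {P : Type*} [Fintype P] (B : Set (Finset P)) (t k v : ℕ) : Prop :=
  2 ≤ t ∧ IsDesign B t v k 1

/-! ### Cyclic codes and BCH codes -/

section BCH

variable (F : Type*) [Field F]

/-- The identification of a word `(c_0, …, c_{n-1})` with the class of
`c_0 + c_1 x + ⋯ + c_{n-1} x ^ (n-1)` in `F[x] / (x ^ n - 1)`. -/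
noncomputable def wordClass (n : ℕ) : (Fin n → F) →ₗ[F] AdjoinRoot (X ^ n - 1 : F[X]) :=
  Fintype.linearCombination F fun i : Fin n => AdjoinRoot.root (X ^ n - 1 : F[X]) ^ (i : ℕ)

/-- The cyclic code of length `n` corresponding to the ideal of `F[x] / (x ^ n - 1)` that is
generated by the class of `g`. -/
noncomputable def cyclicCode (n : ℕ) (g : F[X]) : Submodule F (Fin n → F) :=
  (Submodule.restrictScalars F
    (Ideal.span {AdjoinRoot.mk (X ^ n - 1 : F[X]) g})).comap (wordClass F n)

variable [DecidableEq F] {K : Type*} [Field K] [Algebra F K]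

/-- With `q = |F|` and `m` the multiplicative order of `q` modulo `n`, the `n`-th root of unity
`β = α ^ ((q ^ m - 1) / n)` attached to `α` in the field `K` of order `q ^ m`. -/
noncomputable def bchRoot (n : ℕ) (α : K) : K :=
  α ^ ((Nat.card F ^ orderOf (Nat.card F : ZMod n) - 1) / n)

/-- The generator polynomial `lcm (M_{β ^ h}, M_{β ^ (h + 1)}, …, M_{β ^ (h + δ - 2)})` of the BCH
code, where `M_γ` is the minimal polynomial of `γ` over `F`. -/
noncomputable def bchGenerator (n δ : ℕ) (h : ℤ) (α : K) : F[X] :=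
  (Finset.range (δ - 1)).lcm fun i => minpoly F (bchRoot F n α ^ (h + (i : ℤ)))

/-- The BCH code `C_(q, n, δ, h)` over `F`, `q = |F|`, of length `n` and designed distance `δ`,
formed with the generator `α` of the multiplicative group of `K`; it is the narrow-sense
BCH code when `h = 1`. -/
noncomputable def bchCode (n δ : ℕ) (h : ℤ) (α : K) : Submodule F (Fin n → F) :=
  cyclicCode F n (bchGenerator F n δ h α)

end BCH

/-! ### Linear algebra of codes -/

section LinearCodeLemmas

variable {F : Type*} [Field F] {n : ℕ}

/-! By Delsarte duality the dual of the BCH code is the trace code `D` of words `Tr (a β^i + b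
β^(2i))`. Each `x = β^i` satisfies `x^q = x⁻¹`, so after multiplication by `x^2` the zeros of such a
word are the `(q+1)`-th roots of unity at which `b x^4 + a x^3 + a^q x + b^q` vanishes: a quartic
without quadratic term.

If `x, y, z` are three distinct such roots, the vanishing of the second elementary symmetric
function forces the fourth root `w` through `w (x+y+z) = -(xy+xz+yz)`. In characteristic three
`x+y+z ≠ 0`, `w` is again a `(q+1)`-th root of unity, and it differs from `x, y, z`. Hence all
nonzero words of `D` vanishing at three given positions have the same zero set, of size four
(`exists_zeroSet_traceWord`).

`IsQuadrupleCode` isolates this property, and everything else follows from it. The 4-element zero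
sets form a Steiner quadruple system. Any three coordinates of `D` are independent, so the duality
between shortening and puncturing (`finrank_dualCode_inf_vanishingOn_compl`) identifies the supports
of weight 4 in the dual of `D` with the blocks and those of weight 5 with the 5-sets containing no
block; minimum-weight supports of `D` are complements of blocks. The designs thus reduce to counting
in a quadruple system, and the weight enumerator to four binomial moments. -/

theorem mem_dualCode {C : Submodule F (Fin n → F)} {x : Fin n → F} :
    x ∈ dualCode C ↔ ∀ c ∈ C, c ⬝ᵥ x = 0 := Iff.rfl

theorem dotProductBilin_isRefl :
    LinearMap.IsRefl (dotProductBilin F F : (Fin n → F) →ₗ[F] (Fin n → F) →ₗ[F] F) := by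
  intro x y h
  simpa [dotProduct_comm] using h

theorem dotProductBilin_nondegenerate :
    LinearMap.Nondegenerate
      (dotProductBilin F F : (Fin n → F) →ₗ[F] (Fin n → F) →ₗ[F] F) := by
  refine dotProductBilin_isRefl.nondegenerate_iff_separatingLeft.2 fun x hx => ?_
  exact dotProduct_eq_zero _ fun w => hx w

theorem finrank_dualCode_add (C : Submodule F (Fin n → F)) :
    Module.finrank F (dualCode C) + Module.finrank F C = n := by
  have h := LinearMap.BilinForm.finrank_orthogonal
    (B := (dotProductBilin F F : LinearMap.BilinForm F (Fin n → F)))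
    dotProductBilin_nondegenerate C
  have hle := Submodule.finrank_le C
  rw [Module.finrank_fin_fun] at h hle
  have h' : Module.finrank F (dualCode C) = n - Module.finrank F C := h
  omega

theorem dualCode_dualCode (C : Submodule F (Fin n → F)) : dualCode (dualCode C) = C :=
  LinearMap.BilinForm.orthogonal_orthogonal
    (B := (dotProductBilin F F : LinearMap.BilinForm F (Fin n → F)))
    dotProductBilin_nondegenerate dotProductBilin_isRefl C

theorem dualCode_sup (C D : Submodule F (Fin n → F)) :
    dualCode (C ⊔ D) = dualCode C ⊓ dualCode D := by
  ext x
  simp only [mem_dualCode, Submodule.mem_inf]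
  refine ⟨fun h => ⟨fun c hc => h c (Submodule.mem_sup_left hc),
    fun c hc => h c (Submodule.mem_sup_right hc)⟩, fun ⟨h₁, h₂⟩ c hc => ?_⟩
  obtain ⟨a, ha, b, hb, rfl⟩ := Submodule.mem_sup.1 hc
  rw [add_dotProduct, h₁ a ha, h₂ b hb, add_zero]

variable (F) in
/-- The space of words that vanish on a set `S` of coordinate positions. -/
def vanishingOn (S : Finset (Fin n)) : Submodule F (Fin n → F) where
  carrier := {c | ∀ i ∈ S, c i = 0}
  zero_mem' := by simp
  add_mem' {a b} ha hb i hi := by simp [ha i hi, hb i hi]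
  smul_mem' r a ha i hi := by simp [ha i hi]

theorem mem_vanishingOn {S : Finset (Fin n)} {c : Fin n → F} :
    c ∈ vanishingOn F S ↔ ∀ i ∈ S, c i = 0 := Iff.rfl

theorem finrank_vanishingOn_add (S : Finset (Fin n)) :
    Module.finrank F (vanishingOn F S) + S.card = n := by
  let r : (Fin n → F) →ₗ[F] (S → F) := LinearMap.funLeft F F (fun i : S => (i : Fin n))
  have hr : Function.Surjective r :=
    LinearMap.funLeft_surjective_of_injective F F _ Subtype.val_injective
  have hk : LinearMap.ker r = vanishingOn F S := by
    ext c
    simp [r, LinearMap.mem_ker, mem_vanishingOn, funext_iff, LinearMap.funLeft_apply]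
  have h := LinearMap.finrank_range_add_finrank_ker r
  rw [LinearMap.range_eq_top.2 hr, finrank_top, hk] at h
  simp only [Module.finrank_fintype_fun_eq_card, Fintype.card_coe, Fintype.card_fin] at h
  omega

theorem dualCode_vanishingOn (S : Finset (Fin n)) :
    dualCode (vanishingOn F S) = vanishingOn F Sᶜ := by
  ext x
  rw [mem_dualCode, mem_vanishingOn]
  constructor
  · intro h i hi
    have := h (Pi.single i 1) (by
      intro j hj
      refine Pi.single_eq_of_ne (fun e => ?_) _
      subst e
      exact Finset.mem_compl.1 hi hj)
    simpa using this
  · intro h c hc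
    refine Finset.sum_eq_zero fun i _ => ?_
    by_cases hi : i ∈ S
    · rw [hc i hi, zero_mul]
    · rw [h i (Finset.mem_compl.2 hi), mul_zero]

/-- Shortening the dual code against puncturing the code. -/
theorem finrank_dualCode_inf_vanishingOn_compl (D : Submodule F (Fin n → F))
    (S : Finset (Fin n)) :
    Module.finrank F ↥(dualCode D ⊓ vanishingOn F Sᶜ) + Module.finrank F D =
      S.card + Module.finrank F ↥(D ⊓ vanishingOn F S) := by
  have h₁ := finrank_dualCode_add (D ⊔ vanishingOn F S)
  rw [dualCode_sup, dualCode_vanishingOn] at h₁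
  have h₂ := Submodule.finrank_sup_add_finrank_inf_eq D (vanishingOn F S)
  have h₃ := finrank_vanishingOn_add (F := F) S
  omega

/-- One more zero lowers the dimension by at most one. -/
theorem finrank_inf_vanishingOn_le_insert (D : Submodule F (Fin n → F)) (S : Finset (Fin n))
    (i : Fin n) :
    Module.finrank F ↥(D ⊓ vanishingOn F S) ≤
      Module.finrank F ↥(D ⊓ vanishingOn F (insert i S)) + 1 := by
  let e : ↥(D ⊓ vanishingOn F S) →ₗ[F] F :=
    (LinearMap.proj i).comp (D ⊓ vanishingOn F S).subtype
  have h := LinearMap.finrank_range_add_finrank_ker e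
  have h₁ : Module.finrank F (LinearMap.range e) ≤ 1 :=
    (Submodule.finrank_le _).trans_eq (Module.finrank_self F)
  have h₂ : Module.finrank F (LinearMap.ker e) ≤
      Module.finrank F ↥(D ⊓ vanishingOn F (insert i S)) := by
    rw [← Submodule.finrank_map_subtype_eq]
    refine Submodule.finrank_mono ?_
    rintro _ ⟨⟨c, hc⟩, hk, rfl⟩
    refine ⟨hc.1, fun j hj => ?_⟩
    rcases Finset.mem_insert.1 hj with rfl | hj
    · exact hk
    · exact hc.2 j hj
  omega

theorem finrank_inf_vanishingOn_le_union (D : Submodule F (Fin n → F)) (S T : Finset (Fin n)) :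
    Module.finrank F ↥(D ⊓ vanishingOn F S) ≤
      Module.finrank F ↥(D ⊓ vanishingOn F (T ∪ S)) + T.card := by
  induction T using Finset.induction_on with
  | empty => rw [Finset.empty_union, Finset.card_empty, add_zero]
  | insert i T hi ih =>
    have := finrank_inf_vanishingOn_le_insert D (T ∪ S) i
    rw [Finset.insert_union, Finset.card_insert_of_notMem hi]
    omega

theorem finrank_le_inf_vanishingOn (D : Submodule F (Fin n → F)) (S : Finset (Fin n)) :
    Module.finrank F D ≤ Module.finrank F ↥(D ⊓ vanishingOn F S) + S.card := by
  have h := finrank_inf_vanishingOn_le_union D ∅ S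
  have h₀ : D ⊓ vanishingOn F (∅ : Finset (Fin n)) = D :=
    inf_eq_left.2 fun c _ i hi => absurd hi (Finset.notMem_empty i)
  rwa [h₀, Finset.union_empty] at h

variable [DecidableEq F]

/-- The set of the zero coordinate positions of a word. -/
def zeroSet (c : Fin n → F) : Finset (Fin n) := Finset.univ.filter fun i => c i = 0

theorem mem_zeroSet {c : Fin n → F} {i : Fin n} : i ∈ zeroSet c ↔ c i = 0 := by
  simp [zeroSet]

theorem mem_vanishingOn_iff_subset {S : Finset (Fin n)} {c : Fin n → F} :
    c ∈ vanishingOn F S ↔ S ⊆ zeroSet c := by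
  simp [mem_vanishingOn, Finset.subset_iff, mem_zeroSet]

theorem wordSupport_eq_compl (c : Fin n → F) : wordSupport c = (zeroSet c)ᶜ := by
  ext i; simp [wordSupport, zeroSet]

theorem mem_vanishingOn_compl_iff_subset {S : Finset (Fin n)} {c : Fin n → F} :
    c ∈ vanishingOn F Sᶜ ↔ wordSupport c ⊆ S := by
  rw [mem_vanishingOn_iff_subset, wordSupport_eq_compl]
  exact compl_le_iff_compl_le

theorem card_wordSupport (c : Fin n → F) : (wordSupport c).card = hammingNorm c := rfl

theorem card_zeroSet_add_hammingNorm (c : Fin n → F) :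
    (zeroSet c).card + hammingNorm c = n := by
  rw [← card_wordSupport, wordSupport_eq_compl, Finset.card_add_card_compl, Fintype.card_fin]

theorem hasParameters_iff {C : Submodule F (Fin n → F)} {k d : ℕ} :
    HasParameters C k d ↔ Module.finrank F C = k ∧
      (∃ c ∈ C, c ≠ 0 ∧ hammingNorm c = d) ∧ ∀ c ∈ C, c ≠ 0 → d ≤ hammingNorm c := by
  unfold HasParameters IsLeast
  refine and_congr_right fun _ => and_congr ?_ ?_
  · constructor
    · rintro ⟨x, hx, y, hy, hxy, h⟩
      refine ⟨-x + y, C.add_mem (C.neg_mem hx) hy,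
        fun e => hxy (neg_add_eq_zero.1 e), ?_⟩
      rw [← h, hammingDist_eq_hammingNorm]
    · rintro ⟨c, hc, h0, h⟩
      exact ⟨c, hc, 0, C.zero_mem, h0, by rw [hammingDist_zero_right, h]⟩
  · constructor
    · intro h c hc h0
      exact h ⟨c, hc, 0, C.zero_mem, h0, hammingDist_zero_right c⟩
    · rintro h w ⟨x, hx, y, hy, hxy, rfl⟩
      rw [hammingDist_eq_hammingNorm]
      exact h _ (C.add_mem (C.neg_mem hx) hy) fun e => hxy (neg_add_eq_zero.1 e)

end LinearCodeLemmas

/-! ### Counting in Steiner quadruple systems -/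

section QuadrupleSystem

variable {P : Type*} [Fintype P] [DecidableEq P]

/-- A family of `4`-sets such that each `3`-set lies in exactly one of them. -/
structure IsQuadrupleSystem (𝓑 : Finset (Finset P)) : Prop where
  card_eq : ∀ B ∈ 𝓑, B.card = 4
  existsUnique : ∀ T : Finset P, T.card = 3 → ∃! B, B ∈ 𝓑 ∧ T ⊆ B

/-- The number of blocks containing a given set. -/
def blockDegree (𝓑 : Finset (Finset P)) (I : Finset P) : ℕ := (𝓑.filter (I ⊆ ·)).card

namespace IsQuadrupleSystem

variable {𝓑 : Finset (Finset P)} (h : IsQuadrupleSystem 𝓑)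
include h

/-- Double count of pairs `(x, B)` with `x ∉ I` and `insert x I ⊆ B`. Descending from triples, it
yields all block degrees. -/
theorem blockDegree_step (I : Finset P) :
    ∑ x ∈ Iᶜ, blockDegree 𝓑 (insert x I) = (4 - I.card) * blockDegree 𝓑 I := by
  have hx : ∀ x ∈ Iᶜ, blockDegree 𝓑 (insert x I) =
      ∑ B ∈ 𝓑.filter (I ⊆ ·), if x ∈ B then 1 else 0 := by
    intro x _
    rw [← Finset.card_filter, Finset.filter_filter, blockDegree]
    congr 1
    ext B
    simp [Finset.insert_subset_iff, and_comm]
  rw [Finset.sum_congr rfl hx, Finset.sum_comm, blockDegree, mul_comm, ← smul_eq_mul,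
    ← Finset.sum_const]
  refine Finset.sum_congr rfl fun B hB => ?_
  rw [Finset.mem_filter] at hB
  rw [← Finset.card_filter, ← h.card_eq B hB.1, ← Finset.card_sdiff_of_subset hB.2]
  congr 1
  ext x
  simp [and_comm]

omit [Fintype P] in
theorem blockDegree_of_card_eq_three {I : Finset P} (hI : I.card = 3) : blockDegree 𝓑 I = 1 := by
  obtain ⟨B, hB, hu⟩ := h.existsUnique I hI
  refine Finset.card_eq_one.2 ⟨B, ?_⟩
  ext B'
  simp only [Finset.mem_filter, Finset.mem_singleton]
  exact ⟨fun hB' => hu B' hB', fun e => e ▸ hB⟩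

theorem blockDegree_of_card_eq_two {I : Finset P} (hI : I.card = 2) :
    2 * blockDegree 𝓑 I = Fintype.card P - 2 := by
  have := h.blockDegree_step I
  rw [Finset.sum_congr rfl fun x hx => h.blockDegree_of_card_eq_three (I := insert x I)
    (by rw [Finset.card_insert_of_notMem (Finset.mem_compl.1 hx), hI])] at this
  simp only [Finset.sum_const, Finset.card_compl, hI, smul_eq_mul, mul_one] at this
  omega

theorem blockDegree_of_card_eq_one {I : Finset P} (hI : I.card = 1) :
    6 * blockDegree 𝓑 I = (Fintype.card P - 1) * (Fintype.card P - 2) := by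
  have := congrArg (2 * ·) (h.blockDegree_step I)
  simp only [Finset.mul_sum] at this
  rw [Finset.sum_congr rfl fun x hx => h.blockDegree_of_card_eq_two (I := insert x I)
    (by rw [Finset.card_insert_of_notMem (Finset.mem_compl.1 hx), hI])] at this
  simp only [Finset.sum_const, Finset.card_compl, hI, smul_eq_mul] at this
  omega

theorem card_mul_24 :
    24 * 𝓑.card = Fintype.card P * ((Fintype.card P - 1) * (Fintype.card P - 2)) := by
  have := congrArg (6 * ·) (h.blockDegree_step ∅)
  simp only [Finset.mul_sum] at this
  rw [Finset.sum_congr rfl fun x hx => h.blockDegree_of_card_eq_one (I := insert x ∅)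
    (by simp)] at this
  simp only [Finset.sum_const, Finset.card_compl, Finset.card_empty, smul_eq_mul, blockDegree,
    Finset.empty_subset, Finset.filter_true, tsub_zero] at this
  omega

/-- Inclusion-exclusion over the three points of `T`; blocks missing `T` are the ones whose
complement contains `T`. -/
theorem card_filter_disjoint_mul_24 {T : Finset P} (hT : T.card = 3) :
    (24 * (𝓑.filter (Disjoint T)).card : ℤ) =
      ((Fintype.card P : ℤ) - 4) * (Fintype.card P - 5) * (Fintype.card P - 6) := by
  have hv : 3 ≤ Fintype.card P := hT ▸ Finset.card_le_univ T
  obtain ⟨x, y, z, hxy, hxz, hyz, rfl⟩ := Finset.card_eq_three.1 hT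
  have key : ((𝓑.filter (Disjoint {x, y, z})).card : ℤ) =
      𝓑.card - blockDegree 𝓑 {x} - blockDegree 𝓑 {y} - blockDegree 𝓑 {z}
        + blockDegree 𝓑 {x, y} + blockDegree 𝓑 {x, z} + blockDegree 𝓑 {y, z}
        - blockDegree 𝓑 {x, y, z} := by
    have h0 : (𝓑.card : ℤ) = ∑ B ∈ 𝓑, 1 := by simp
    simp only [blockDegree, Finset.card_filter, h0]
    push_cast
    simp only [← Finset.sum_sub_distrib, ← Finset.sum_add_distrib]
    refine Finset.sum_congr rfl fun B _ => ?_
    by_cases hx : x ∈ B <;> by_cases hy : y ∈ B <;> by_cases hz : z ∈ B <;>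
      simp [Finset.insert_subset_iff, hx, hy, hz]
  have e1 : ∀ a : P, (6 * blockDegree 𝓑 {a} : ℤ) =
      ((Fintype.card P : ℤ) - 1) * (Fintype.card P - 2) := by
    intro a
    have := h.blockDegree_of_card_eq_one (Finset.card_singleton a)
    zify [show 1 ≤ Fintype.card P by omega, show 2 ≤ Fintype.card P by omega] at this
    exact this
  have e2 : ∀ a b : P, a ≠ b → (2 * blockDegree 𝓑 {a, b} : ℤ) = (Fintype.card P : ℤ) - 2 := by
    intro a b hab
    have := h.blockDegree_of_card_eq_two (Finset.card_pair hab)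
    zify [show 2 ≤ Fintype.card P by omega] at this
    exact this
  have e0 := h.card_mul_24
  zify [show 1 ≤ Fintype.card P by omega, show 2 ≤ Fintype.card P by omega] at e0
  rw [key, h.blockDegree_of_card_eq_three hT]
  push_cast
  linear_combination e0 - 4 * e1 x - 4 * e1 y - 4 * e1 z + 12 * e2 x y hxy + 12 * e2 x z hxz
    + 12 * e2 y z hyz

omit [Fintype P] [DecidableEq P] in
theorem eq_of_three_le_card_inter {B B' : Finset P} (hB : B ∈ 𝓑) (hB' : B' ∈ 𝓑)
    {T : Finset P} (hT : T.card = 3) (hTB : T ⊆ B) (hTB' : T ⊆ B') : B = B' :=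
  (h.existsUnique T hT).unique ⟨hB, hTB⟩ ⟨hB', hTB'⟩

omit [Fintype P] in
theorem exists_insert_mem {T : Finset P} (hT : T.card = 3) : ∃ r, r ∉ T ∧ insert r T ∈ 𝓑 := by
  obtain ⟨B, ⟨hB, hTB⟩, _⟩ := h.existsUnique T hT
  have hc : T.card < B.card := by rw [hT, h.card_eq B hB]; norm_num
  obtain ⟨r, hrB, hrT⟩ := Finset.exists_mem_notMem_of_card_lt_card hc
  refine ⟨r, hrT, ?_⟩
  rwa [Finset.eq_of_subset_of_card_le (Finset.insert_subset hrB hTB)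
    (by rw [Finset.card_insert_of_notMem hrT, hT, h.card_eq B hB])]

omit [Fintype P] in
theorem eq_of_insert_mem {T : Finset P} (hT : T.card = 3) {r r' : P} (hr : r ∉ T)
    (hB : insert r T ∈ 𝓑) (hB' : insert r' T ∈ 𝓑) : r = r' := by
  have e := h.eq_of_three_le_card_inter hB hB' hT (Finset.subset_insert _ _)
    (Finset.subset_insert _ _)
  have : r ∈ insert r' T := e ▸ Finset.mem_insert_self r T
  exact (Finset.mem_insert.1 this).resolve_right hr

/-- The points completing some `3`-subset of a non-block `Q` to a block. -/
theorem card_completions {Q : Finset P} (hQ : Q.card = 4) (hQB : Q ∉ 𝓑) :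
    (Qᶜ.filter fun r => ∃ T ∈ Q.powersetCard 3, insert r T ∈ 𝓑).card = 4 := by
  have hex : ∀ T : Finset P, ∃ r, T.card = 3 → r ∉ T ∧ insert r T ∈ 𝓑 := by
    intro T
    by_cases hT : T.card = 3
    · obtain ⟨r, hr⟩ := h.exists_insert_mem hT
      exact ⟨r, fun _ => hr⟩
    -- Dummy value, needed only to make the choice function total.
    · obtain ⟨r, -⟩ := Finset.card_pos.1 (by omega : 0 < Q.card)
      exact ⟨r, fun h' => absurd h' hT⟩
  choose f hf using hex
  have h4 : (Q.powersetCard 3).card = 4 := by rw [Finset.card_powersetCard, hQ]; rfl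
  rw [← h4]
  symm
  refine Finset.card_bij (fun T _ => f T) ?_ ?_ ?_
  · intro T hT
    obtain ⟨hTQ, hT3⟩ := Finset.mem_powersetCard.1 hT
    refine Finset.mem_filter.2 ⟨Finset.mem_compl.2 fun hfQ => hQB ?_, T, hT, (hf T hT3).2⟩
    rw [← Finset.eq_of_subset_of_card_le (Finset.insert_subset hfQ hTQ)
      (by rw [Finset.card_insert_of_notMem (hf T hT3).1, hT3, hQ])]
    exact (hf T hT3).2
  · intro T hT T' hT' e
    obtain ⟨hTQ, hT3⟩ := Finset.mem_powersetCard.1 hT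
    obtain ⟨hTQ', hT3'⟩ := Finset.mem_powersetCard.1 hT'
    have hB := (hf T hT3).2
    have hB' := (hf T' hT3').2
    have hr := (hf T hT3).1
    have hr' := (hf T' hT3').1
    rw [← e] at hB' hr'
    -- Two 3-subsets of `Q` share two points; with the common completing point the two blocks share
    -- three, hence coincide.
    have hi : 2 ≤ (T ∩ T').card := by
      have h1 := Finset.card_union_add_card_inter T T'
      have h2 := Finset.card_le_card (Finset.union_subset hTQ hTQ')
      omega
    obtain ⟨S, hS, hS2⟩ := Finset.exists_subset_card_eq hi
    have hSc : (insert (f T) S).card = 3 := by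
      rw [Finset.card_insert_of_notMem
        fun hm => hr (Finset.mem_of_mem_inter_left (hS hm)), hS2]
    have := h.eq_of_three_le_card_inter hB hB' hSc
      (Finset.insert_subset_insert _ (hS.trans Finset.inter_subset_left))
      (Finset.insert_subset_insert _ (hS.trans Finset.inter_subset_right))
    rw [← Finset.erase_insert hr, this, Finset.erase_insert hr']
  · intro r hr
    obtain ⟨hrQ, T, hT, hB⟩ := Finset.mem_filter.1 hr
    obtain ⟨hTQ, hT3⟩ := Finset.mem_powersetCard.1 hT
    exact ⟨T, hT, h.eq_of_insert_mem hT3 (hf T hT3).1 (hf T hT3).2 hB⟩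

omit h in
variable (𝓑) in
/-- The `5`-sets that contain no block. -/
def blockFreeFiveSets : Finset (Finset P) :=
  (Finset.univ.powersetCard 5).filter fun S => ∀ B ∈ 𝓑, ¬ B ⊆ S

omit h in
theorem mem_blockFreeFiveSets {S : Finset P} :
    S ∈ blockFreeFiveSets 𝓑 ↔ S.card = 5 ∧ ∀ B ∈ 𝓑, ¬ B ⊆ S := by
  simp [blockFreeFiveSets, Finset.mem_powersetCard]

/-- Adding a point to `Q` creates a block exactly when the point completes a triple of `Q`, which
rules out four of the remaining points. -/
theorem card_blockFree_of_four_subset {Q : Finset P} (hQ : Q.card = 4) (hQB : Q ∉ 𝓑) :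
    ((blockFreeFiveSets 𝓑).filter (Q ⊆ ·)).card = Fintype.card P - 8 := by
  set bad := Qᶜ.filter fun r => ∃ T ∈ Q.powersetCard 3, insert r T ∈ 𝓑 with hbad
  have hcard : (Qᶜ \ bad).card = Fintype.card P - 8 := by
    rw [Finset.card_sdiff_of_subset (Finset.filter_subset _ _), h.card_completions hQ hQB,
      Finset.card_compl, hQ]
    omega
  rw [← hcard]
  symm
  refine Finset.card_bij (fun r _ => insert r Q) ?_ ?_ ?_
  · intro r hr
    obtain ⟨hrQ, hrb⟩ := Finset.mem_sdiff.1 hr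
    have hrQ' := Finset.mem_compl.1 hrQ
    refine Finset.mem_filter.2 ⟨mem_blockFreeFiveSets.2 ⟨?_, fun B hB hBS => hrb ?_⟩,
      Finset.subset_insert _ _⟩
    · rw [Finset.card_insert_of_notMem hrQ', hQ]
    · have hrB : r ∈ B := by
        by_contra hrB
        refine hQB ?_
        rwa [← Finset.eq_of_subset_of_card_le ((Finset.subset_insert_iff_of_notMem hrB).1 hBS)
          (by rw [hQ, h.card_eq B hB])]
      refine Finset.mem_filter.2 ⟨hrQ, B.erase r, Finset.mem_powersetCard.2
        ⟨Finset.subset_insert_iff.1 hBS, ?_⟩, ?_⟩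
      · rw [Finset.card_erase_of_mem hrB, h.card_eq B hB]
      · rwa [Finset.insert_erase hrB]
  · intro r hr r' hr' e
    have hrQ := Finset.mem_compl.1 (Finset.mem_sdiff.1 hr).1
    have : r ∈ insert r' Q := by
        exact e ▸ Finset.mem_insert_self r Q
    exact (Finset.mem_insert.1 this).resolve_right hrQ
  · intro S hS
    obtain ⟨hS, hQS⟩ := Finset.mem_filter.1 hS
    obtain ⟨hS5, hSB⟩ := mem_blockFreeFiveSets.1 hS
    obtain ⟨r, hrS, hrQ⟩ := Finset.exists_mem_notMem_of_card_lt_card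
      (by omega : Q.card < S.card)
    have e : insert r Q = S := Finset.eq_of_subset_of_card_le (Finset.insert_subset hrS hQS)
      (by rw [Finset.card_insert_of_notMem hrQ, hQ, hS5])
    refine ⟨r, Finset.mem_sdiff.2 ⟨Finset.mem_compl.2 hrQ, fun hb => ?_⟩, e⟩
    obtain ⟨_, T, hT, hB⟩ := Finset.mem_filter.1 hb
    refine hSB _ hB ?_
    rw [← e]
    exact Finset.insert_subset_insert _ (Finset.mem_powersetCard.1 hT).1

/-- Double count of pairs `(p, S)` with `p ∈ S \ T`: each `S` occurs twice, the point completing `T`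
to a block never occurs, and every other `p` has the count for the non-block `insert p T`. -/
theorem card_blockFree_of_three_subset {T : Finset P} (hT : T.card = 3) :
    2 * ((blockFreeFiveSets 𝓑).filter (T ⊆ ·)).card =
      (Fintype.card P - 4) * (Fintype.card P - 8) := by
  set E := (blockFreeFiveSets 𝓑).filter (T ⊆ ·) with hE
  have h1 : ∑ S ∈ E, ∑ p ∈ Tᶜ, (if p ∈ S then 1 else 0) = E.card * 2 := by
    rw [← smul_eq_mul, ← Finset.sum_const]
    refine Finset.sum_congr rfl fun S hS => ?_
    obtain ⟨hS, hTS⟩ := Finset.mem_filter.1 hS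
    obtain ⟨hS5, -⟩ := mem_blockFreeFiveSets.1 hS
    have h2 : (S \ T).card = 2 := by rw [Finset.card_sdiff_of_subset hTS]; omega
    rw [← Finset.card_filter, ← h2]
    congr 1
    ext x
    simp [and_comm]
  obtain ⟨r, hrT, hrB⟩ := h.exists_insert_mem hT
  have h2 : ∀ p ∈ Tᶜ, (∑ S ∈ E, if p ∈ S then 1 else 0) =
      if p ≠ r then Fintype.card P - 8 else 0 := by
    intro p hp
    have hpT := Finset.mem_compl.1 hp
    have hc : (insert p T).card = 4 := by rw [Finset.card_insert_of_notMem hpT, hT]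
    have e : E.filter (p ∈ ·) = (blockFreeFiveSets 𝓑).filter (insert p T ⊆ ·) := by
      rw [hE, Finset.filter_filter]
      ext S
      simp [Finset.insert_subset_iff, and_comm]
    rw [← Finset.card_filter, e]
    split_ifs with hpr
    · exact h.card_blockFree_of_four_subset hc
        fun hB => hpr (h.eq_of_insert_mem hT hpT hB hrB)
    · rw [not_not] at hpr
      subst hpr
      refine Finset.card_eq_zero.2 (Finset.filter_eq_empty_iff.2 fun S hS => ?_)
      exact (mem_blockFreeFiveSets.1 hS).2 _ hrB
  rw [Finset.sum_comm, Finset.sum_congr rfl h2, ← Finset.sum_filter, Finset.sum_const,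
    Finset.filter_ne', Finset.card_erase_of_mem (Finset.mem_compl.2 hrT), Finset.card_compl, hT,
    smul_eq_mul] at h1
  rw [mul_comm, ← h1]
  congr 1

end IsQuadrupleSystem

end QuadrupleSystem

/-! ### Four-dimensional codes whose triples of zeros complete to quadruples -/

section QuadrupleCode

variable {F : Type*} [Field F] [DecidableEq F] {n : ℕ}

/-- A four-dimensional code of length at least `5` such that for each `3`-set `T` of positions
all nonzero codewords vanishing on `T` have the same zero set, of size `4`. -/
structure IsQuadrupleCode (D : Submodule F (Fin n → F)) : Prop where
  five_le : 5 ≤ n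
  finrank_eq : Module.finrank F D = 4
  exists_zeroSet : ∀ T : Finset (Fin n), T.card = 3 → ∃ B : Finset (Fin n), T ⊆ B ∧ B.card = 4 ∧
    ∀ c ∈ D, c ≠ 0 → T ⊆ zeroSet c → zeroSet c = B

open Classical in
/-- The zero sets of size `4` of the nonzero codewords. -/
noncomputable def zeroQuadruples (D : Submodule F (Fin n → F)) : Finset (Finset (Fin n)) :=
  (Finset.univ.powersetCard 4).filter fun B => ∃ c ∈ D, c ≠ 0 ∧ zeroSet c = B

theorem mem_zeroQuadruples {D : Submodule F (Fin n → F)} {B : Finset (Fin n)} :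
    B ∈ zeroQuadruples D ↔ B.card = 4 ∧ ∃ c ∈ D, c ≠ 0 ∧ zeroSet c = B := by
  simp [zeroQuadruples, Finset.mem_powersetCard]

namespace IsQuadrupleCode

variable {D : Submodule F (Fin n → F)} (h : IsQuadrupleCode D)
include h

theorem card_zeroSet_cases {c : Fin n → F} (hc : c ∈ D) (h0 : c ≠ 0) :
    (zeroSet c).card = 0 ∨ (zeroSet c).card = 1 ∨ (zeroSet c).card = 2 ∨
      (zeroSet c).card = 4 := by
  by_cases h3 : 3 ≤ (zeroSet c).card
  · obtain ⟨T, hT, hT3⟩ := Finset.exists_subset_card_eq h3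
    obtain ⟨B, -, hB, hu⟩ := h.exists_zeroSet T hT3
    rw [hu c hc h0 hT, hB]
    simp
  · omega

theorem card_zeroSet_le {c : Fin n → F} (hc : c ∈ D) (h0 : c ≠ 0) : (zeroSet c).card ≤ 4 := by
  rcases h.card_zeroSet_cases hc h0 with h | h | h | h <;> omega

theorem finrank_of_five_le {S : Finset (Fin n)} (hS : 5 ≤ S.card) :
    Module.finrank F ↥(D ⊓ vanishingOn F S) = 0 := by
  have : D ⊓ vanishingOn F S = ⊥ := by
    refine (Submodule.eq_bot_iff _).2 fun c ⟨hc, hcS⟩ => ?_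
    by_contra h0
    have h1 := Finset.card_le_card (mem_vanishingOn_iff_subset.1 hcS)
    have h2 := h.card_zeroSet_le hc h0
    omega
  rw [this, finrank_bot]

/-- Three conditions leave dimension at least one; one further zero outside the quadruple of `T`
leaves nothing. -/
theorem finrank_of_card_eq_three {T : Finset (Fin n)} (hT : T.card = 3) :
    Module.finrank F ↥(D ⊓ vanishingOn F T) = 1 := by
  have h1 := finrank_le_inf_vanishingOn D T
  rw [h.finrank_eq, hT] at h1
  obtain ⟨B, hTB, hB, hu⟩ := h.exists_zeroSet T hT
  have hn := h.five_le
  obtain ⟨j, -, hj⟩ := Finset.exists_mem_notMem_of_card_lt_card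
    (s := B) (t := Finset.univ) (by rw [hB, Finset.card_fin]; omega)
  have h2 := finrank_inf_vanishingOn_le_insert D T j
  have : D ⊓ vanishingOn F (insert j T) = ⊥ := by
    refine (Submodule.eq_bot_iff _).2 fun c ⟨hc, hcS⟩ => ?_
    by_contra h0
    have hs := mem_vanishingOn_iff_subset.1 hcS
    rw [Finset.insert_subset_iff] at hs
    exact hj (hu c hc h0 hs.2 ▸ hs.1)
  rw [this, finrank_bot] at h2
  omega

theorem finrank_of_card_le_three {S : Finset (Fin n)} (hS : S.card ≤ 3) :
    Module.finrank F ↥(D ⊓ vanishingOn F S) + S.card = 4 := by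
  have h1 := finrank_le_inf_vanishingOn D S
  rw [h.finrank_eq] at h1
  obtain ⟨T, hST, -, hT⟩ := Finset.exists_subsuperset_card_eq (Finset.subset_univ S) hS
    (by rw [Finset.card_fin]; have := h.five_le; omega)
  have h2 := finrank_inf_vanishingOn_le_union D S (T \ S)
  rw [Finset.sdiff_union_of_subset hST, h.finrank_of_card_eq_three hT,
    Finset.card_sdiff_of_subset hST, hT] at h2
  omega

theorem isQuadrupleSystem : IsQuadrupleSystem (zeroQuadruples D) where
  card_eq B hB := (mem_zeroQuadruples.1 hB).1
  existsUnique T hT := by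
    obtain ⟨B, hTB, hB, hu⟩ := h.exists_zeroSet T hT
    have h1 : D ⊓ vanishingOn F T ≠ ⊥ := fun e => by
      have := h.finrank_of_card_eq_three hT
      rw [e, finrank_bot] at this
      omega
    obtain ⟨c, ⟨hc, hcT⟩, h0⟩ := Submodule.exists_mem_ne_zero_of_ne_bot h1
    refine ⟨B, ⟨mem_zeroQuadruples.2 ⟨hB, c, hc, h0,
      hu c hc h0 (mem_vanishingOn_iff_subset.1 hcT)⟩, hTB⟩, ?_⟩
    rintro B' ⟨hB', hTB'⟩
    obtain ⟨-, c', hc', h0', rfl⟩ := mem_zeroQuadruples.1 hB'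
    exact hu c' hc' h0' hTB'

theorem exists_zeroQuadruple : ∃ B, B ∈ zeroQuadruples D := by
  obtain ⟨T, -, hT⟩ := Finset.exists_subset_card_eq
    (s := (Finset.univ : Finset (Fin n))) (n := 3) (by
      rw [Finset.card_fin]; have := h.five_le; omega)
  obtain ⟨B, hB, -⟩ := h.isQuadrupleSystem.existsUnique T hT
  exact ⟨B, hB.1⟩

theorem four_le_hammingNorm_dual {c : Fin n → F} (hc : c ∈ dualCode D) (h0 : c ≠ 0) :
    4 ≤ hammingNorm c := by
  by_contra hlt
  rw [← card_wordSupport] at hlt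
  have h1 := finrank_dualCode_inf_vanishingOn_compl D (wordSupport c)
  have h2 := h.finrank_of_card_le_three (S := wordSupport c) (by omega)
  rw [h.finrank_eq] at h1
  have h3 : dualCode D ⊓ vanishingOn F (wordSupport c)ᶜ = ⊥ :=
    Submodule.finrank_eq_zero.1 (by omega)
  exact h0 ((Submodule.eq_bot_iff _).1 h3 c
    ⟨hc, mem_vanishingOn_compl_iff_subset.2 subset_rfl⟩)

omit h in
theorem exists_dual_of_finrank_pos {S : Finset (Fin n)}
    (hS : 0 < Module.finrank F ↥(dualCode D ⊓ vanishingOn F Sᶜ)) :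
    ∃ c ∈ dualCode D, c ≠ 0 ∧ wordSupport c ⊆ S := by
  obtain ⟨c, ⟨hc, hcS⟩, h0⟩ := Submodule.exists_mem_ne_zero_of_ne_bot
    (p := dualCode D ⊓ vanishingOn F Sᶜ) (fun e => by rw [e, finrank_bot] at hS; omega)
  exact ⟨c, hc, h0, mem_vanishingOn_compl_iff_subset.1 hcS⟩

/-- For `|S| = 4` the dual words supported in `S` and the words of `D` vanishing on `S` span spaces
of equal dimension. Since dual weights are at least 4 and zero sets have at most 4 points, nonzero
words of either kind fill `S`. -/
theorem supportBlocks_dual_four : supportBlocks (dualCode D) 4 = ↑(zeroQuadruples D) := by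
  ext S
  rw [Finset.mem_coe, mem_zeroQuadruples]
  have h1 := finrank_dualCode_inf_vanishingOn_compl D S
  rw [h.finrank_eq] at h1
  constructor
  · rintro ⟨c, hc, hc4, rfl⟩
    have h0 : c ≠ 0 := by
      rintro rfl
      simp at hc4
    rw [card_wordSupport] at h1 ⊢
    refine ⟨hc4, ?_⟩
    have h2 : dualCode D ⊓ vanishingOn F (wordSupport c)ᶜ ≠ ⊥ := fun e =>
      h0 ((Submodule.eq_bot_iff _).1 e c ⟨hc, mem_vanishingOn_compl_iff_subset.2 subset_rfl⟩)
    have h3 : D ⊓ vanishingOn F (wordSupport c) ≠ ⊥ := fun e => by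
      rw [e, finrank_bot] at h1
      exact h2 (Submodule.finrank_eq_zero.1 (by omega))
    obtain ⟨d, ⟨hd, hds⟩, hd0⟩ := Submodule.exists_mem_ne_zero_of_ne_bot h3
    refine ⟨d, hd, hd0, (Finset.eq_of_subset_of_card_le (mem_vanishingOn_iff_subset.1 hds) ?_).symm⟩
    rw [card_wordSupport, hc4]
    exact h.card_zeroSet_le hd hd0
  · rintro ⟨hS, d, hd, hd0, rfl⟩
    have h2 : D ⊓ vanishingOn F (zeroSet d) ≠ ⊥ := fun e =>
      hd0 ((Submodule.eq_bot_iff _).1 e d ⟨hd, mem_vanishingOn_iff_subset.2 subset_rfl⟩)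
    have h3 : Module.finrank F ↥(D ⊓ vanishingOn F (zeroSet d)) ≠ 0 :=
      fun e => h2 (Submodule.finrank_eq_zero.1 e)
    obtain ⟨c, hc, h0, hcS⟩ := exists_dual_of_finrank_pos (D := D) (S := zeroSet d) (by omega)
    have h4 := h.four_le_hammingNorm_dual hc h0
    have e := Finset.eq_of_subset_of_card_le hcS (by rw [hS]; exact h4)
    exact ⟨c, hc, by rw [← card_wordSupport, e, hS], e⟩

/-- No nonzero word of `D` vanishes on a 5-set, so the dual words supported in it form a line. Its
generator has weight 4 if the 5-set contains a block and weight 5 otherwise. -/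
theorem supportBlocks_dual_five :
    supportBlocks (dualCode D) 5 = ↑(IsQuadrupleSystem.blockFreeFiveSets (zeroQuadruples D)) := by
  ext S
  rw [Finset.mem_coe, IsQuadrupleSystem.mem_blockFreeFiveSets]
  have h1 := finrank_dualCode_inf_vanishingOn_compl D S
  rw [h.finrank_eq] at h1
  constructor
  · rintro ⟨c, hc, hc5, rfl⟩
    rw [card_wordSupport] at h1 ⊢
    refine ⟨hc5, fun B hB hBc => ?_⟩
    have hcD := hc
    have h0 : c ≠ 0 := by
      rintro rfl
      simp at hc5
    rw [h.finrank_of_five_le (by rw [card_wordSupport]; omega)] at h1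
    have h4 : B ∈ supportBlocks (dualCode D) 4 := by
      rw [h.supportBlocks_dual_four]
      exact hB
    obtain ⟨d, hd, hd4, rfl⟩ := h4
    have hd0 : d ≠ 0 := by
      rintro rfl
      simp at hd4
    obtain ⟨v, hv⟩ := finrank_eq_one_iff'.1 (show Module.finrank F
      ↥(dualCode D ⊓ vanishingOn F (wordSupport c)ᶜ) = 1 by omega)
    obtain ⟨a, ha⟩ := hv.2 ⟨c, hc, mem_vanishingOn_compl_iff_subset.2 subset_rfl⟩
    obtain ⟨b, hb⟩ := hv.2 ⟨d, hd, mem_vanishingOn_compl_iff_subset.2 hBc⟩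
    have ha' := congrArg Subtype.val ha
    have hb' := congrArg Subtype.val hb
    simp only [Submodule.coe_smul] at ha' hb'
    have hb0 : b ≠ 0 := by
      rintro rfl
      rw [zero_smul] at hb'
      exact hd0 hb'.symm
    have hsub : wordSupport c ⊆ wordSupport d := by
      intro i hi
      simp only [wordSupport, Finset.mem_filter, Finset.mem_univ, true_and, ← ha', ← hb',
        Pi.smul_apply, smul_eq_mul] at hi ⊢
      exact mul_ne_zero hb0 (right_ne_zero_of_mul hi)
    have := Finset.card_le_card hsub
    rw [card_wordSupport, card_wordSupport] at this
    omega
  · rintro ⟨hS5, hS⟩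
    obtain ⟨c, hc, h0, hcS⟩ := exists_dual_of_finrank_pos (D := D) (S := S) (by omega)
    have h4 := h.four_le_hammingNorm_dual hc h0
    have h5 : hammingNorm c ≠ 4 := fun e => hS (wordSupport c) (by
      rw [← Finset.mem_coe, ← h.supportBlocks_dual_four]
      exact ⟨c, hc, e, rfl⟩) hcS
    have e := Finset.eq_of_subset_of_card_le hcS (by rw [hS5, card_wordSupport]; omega)
    exact ⟨c, hc, by rw [← card_wordSupport, e, hS5], e⟩

theorem supportBlocks_sub_four :
    supportBlocks D (n - 4) = {S | Sᶜ ∈ zeroQuadruples D} := by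
  have hn := h.five_le
  ext S
  rw [Set.mem_ofPred_eq, mem_zeroQuadruples]
  constructor
  · rintro ⟨c, hc, hw, rfl⟩
    have := card_zeroSet_add_hammingNorm c
    rw [wordSupport_eq_compl, compl_compl]
    refine ⟨by omega, c, hc, ?_, rfl⟩
    rintro rfl
    rw [hammingNorm_zero] at hw
    omega
  · rintro ⟨hS, c, hc, h0, e⟩
    have := card_zeroSet_add_hammingNorm c
    rw [e, hS] at this
    exact ⟨c, hc, by omega, by rw [wordSupport_eq_compl, e, compl_compl]⟩

theorem hasParameters : HasParameters D 4 (n - 4) := by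
  refine hasParameters_iff.2 ⟨h.finrank_eq, ?_, fun c hc h0 => ?_⟩
  · obtain ⟨B, hB⟩ := h.exists_zeroQuadruple
    obtain ⟨hB4, c, hc, h0, rfl⟩ := mem_zeroQuadruples.1 hB
    have := card_zeroSet_add_hammingNorm c
    exact ⟨c, hc, h0, by omega⟩
  · have := card_zeroSet_add_hammingNorm c
    have := h.card_zeroSet_le hc h0
    omega

theorem hasParameters_dual : HasParameters (dualCode D) (n - 4) 4 := by
  have hd := finrank_dualCode_add D
  rw [h.finrank_eq] at hd
  refine hasParameters_iff.2 ⟨by omega, ?_, fun c hc h0 => h.four_le_hammingNorm_dual hc h0⟩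
  obtain ⟨B, hB⟩ := h.exists_zeroQuadruple
  rw [← Finset.mem_coe, ← h.supportBlocks_dual_four] at hB
  obtain ⟨c, hc, h4, -⟩ := hB
  refine ⟨c, hc, ?_, h4⟩
  rintro rfl
  simp at h4

theorem isAMDS : IsAMDS D :=
  ⟨4, n - 4, h.hasParameters, by have := h.five_le; omega⟩

theorem isAMDS_dual : IsAMDS (dualCode D) :=
  ⟨n - 4, 4, h.hasParameters_dual, by have := h.five_le; omega⟩

theorem isDesign_dual_four : IsDesign (supportBlocks (dualCode D) 4) 3 n 4 1 where
  one_le_t := by norm_num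
  t_le_k := by norm_num
  k_le_v := by have := h.five_le; omega
  card_points := Fintype.card_fin n
  card_block := by
    rintro _ ⟨c, -, hw, rfl⟩
    exact hw
  balanced T hT := by
    rw [h.supportBlocks_dual_four, ← h.isQuadrupleSystem.blockDegree_of_card_eq_three hT,
      blockDegree, ← Set.ncard_coe_finset, Finset.coe_filter]
    rfl

/-- The parameter is read off from one triple, which avoids division; `key` makes it the same for
all triples. -/
theorem isDesign_dual_five : ∃ l : ℕ, 2 * l = (n - 4) * (n - 8) ∧
    IsDesign (supportBlocks (dualCode D) 5) 3 n 5 l := by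
  have key : ∀ T : Finset (Fin n), T.card = 3 →
      2 * {S | S ∈ supportBlocks (dualCode D) 5 ∧ T ⊆ S}.ncard = (n - 4) * (n - 8) := by
    intro T hT
    have := h.isQuadrupleSystem.card_blockFree_of_three_subset hT
    rw [Fintype.card_fin, ← Set.ncard_coe_finset, Finset.coe_filter] at this
    rw [h.supportBlocks_dual_five, ← this]
    rfl
  obtain ⟨T, -, hT⟩ := Finset.exists_subset_card_eq
    (s := (Finset.univ : Finset (Fin n))) (n := 3) (by
      rw [Finset.card_fin]; have := h.five_le; omega)
  refine ⟨_, key T hT, by norm_num, by norm_num, h.five_le, Fintype.card_fin n, ?_, ?_⟩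
  · rintro _ ⟨c, -, hw, rfl⟩
    exact hw
  · intro T' hT'
    have h1 := key T hT
    have h2 := key T' hT'
    omega

theorem isDesign_sub_four (hn : 7 ≤ n) : ∃ l : ℕ, 24 * (l : ℤ) = ((n : ℤ) - 4) * (n - 5) * (n - 6) ∧
    IsDesign (supportBlocks D (n - 4)) 3 n (n - 4) l := by
  have key : ∀ T : Finset (Fin n), T.card = 3 →
      24 * ({S | S ∈ supportBlocks D (n - 4) ∧ T ⊆ S}.ncard : ℤ) =
        ((n : ℤ) - 4) * (n - 5) * (n - 6) := by
    intro T hT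
    have := h.isQuadrupleSystem.card_filter_disjoint_mul_24 hT
    rw [Fintype.card_fin] at this
    rw [h.supportBlocks_sub_four, ← this, ← Set.ncard_coe_finset,
      ← Set.ncard_image_of_injective _ (compl_injective (α := Finset (Fin n)))]
    congr 3
    ext S
    simp only [Set.mem_image, Set.mem_ofPred_eq, Finset.coe_filter]
    constructor
    · rintro ⟨R, ⟨hR, hTR⟩, rfl⟩
      exact ⟨hR, disjoint_compl_right_iff.2 hTR⟩
    · rintro ⟨hS, hTS⟩
      exact ⟨Sᶜ, ⟨by rwa [compl_compl], le_compl_iff_disjoint_right.2 hTS⟩, compl_compl S⟩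
  obtain ⟨T, -, hT⟩ := Finset.exists_subset_card_eq
    (s := (Finset.univ : Finset (Fin n))) (n := 3) (by
      rw [Finset.card_fin]; omega)
  refine ⟨_, key T hT, by norm_num, by omega, by omega, Fintype.card_fin n, ?_, ?_⟩
  · rintro _ ⟨c, -, hw, rfl⟩
    exact hw
  · intro T' hT'
    have h1 := key T hT
    have h2 := key T' hT'
    omega

/-! ### Binomial moments and the weight enumerator -/

open Classical in
omit h [DecidableEq F] in
theorem card_filter_vanishingOn [Fintype F] (D : Submodule F (Fin n → F)) (T : Finset (Fin n)) :
    (Finset.univ.filter fun c : Fin n → F => c ∈ D ∧ c ∈ vanishingOn F T).card =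
      Fintype.card F ^ Module.finrank F ↥(D ⊓ vanishingOn F T) := by
  rw [← Module.card_eq_pow_finrank (K := F) (V := ↥(D ⊓ vanishingOn F T)), Fintype.card_subtype]
  simp only [Submodule.mem_inf]

open Classical in
-- Count pairs of a codeword and a `j`-set of its zeros: each `j`-set is killed by a subspace of
-- dimension `4 - j`.
theorem sum_choose_card_zeroSet [Fintype F] {j : ℕ} (hj : j ≤ 3) :
    ∑ c : Fin n → F with c ∈ D, (zeroSet c).card.choose j =
      n.choose j * Fintype.card F ^ (4 - j) := by
  have h1 : ∀ c : Fin n → F, (zeroSet c).card.choose j =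
      ∑ T ∈ Finset.univ.powersetCard j, if T ⊆ zeroSet c then 1 else 0 := by
    intro c
    rw [← Finset.card_powersetCard, ← Finset.card_filter]
    congr 1
    ext T
    simp [Finset.mem_powersetCard, and_comm]
  simp_rw [h1]
  rw [Finset.sum_comm]
  have h2 : ∀ T ∈ Finset.univ.powersetCard j,
      (∑ c : Fin n → F with c ∈ D, if T ⊆ zeroSet c then 1 else 0) =
        Fintype.card F ^ (4 - j) := by
    intro T hT
    have hT' := (Finset.mem_powersetCard.1 hT).2
    have h3 := h.finrank_of_card_le_three (S := T) (by omega)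
    rw [← Finset.card_filter, Finset.filter_filter]
    simp_rw [← mem_vanishingOn_iff_subset]
    rw [card_filter_vanishingOn]
    congr 1
    omega
  rw [Finset.sum_congr rfl h2, Finset.sum_const, Finset.card_powersetCard, Finset.card_fin,
    smul_eq_mul]

omit h in
theorem zeroSet_zero_card : (zeroSet (0 : Fin n → F)).card = n := by
  have := card_zeroSet_add_hammingNorm (0 : Fin n → F)
  rwa [hammingNorm_zero, add_zero] at this

open Classical in
omit h in
theorem weightCount_sub [Fintype F] {i : ℕ} (hi : i ≤ n) : weightCount D (n - i) =
    (Finset.univ.filter fun c : Fin n → F => c ∈ D ∧ (zeroSet c).card = i).card := by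
  rw [weightCount, ← Set.ncard_coe_finset]
  congr 1
  ext c
  have := card_zeroSet_add_hammingNorm c
  simp only [Set.mem_ofPred_eq, Finset.coe_filter, Finset.mem_univ, true_and]
  exact and_congr_right fun _ => by omega

open Classical in
theorem sum_card_zeroSet [Fintype F] (f : ℕ → ℕ) :
    ∑ c : Fin n → F with c ∈ D, f (zeroSet c).card =
      f n + weightCount D n * f 0 + weightCount D (n - 1) * f 1 +
        weightCount D (n - 2) * f 2 + weightCount D (n - 4) * f 4 := by
  have hn := h.five_le
  have h1 : ∀ c ∈ Finset.univ.filter (fun c : Fin n → F => c ∈ D), f (zeroSet c).card =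
      (if c = 0 then f n else 0) + (if (zeroSet c).card = 0 then f 0 else 0) +
      (if (zeroSet c).card = 1 then f 1 else 0) + (if (zeroSet c).card = 2 then f 2 else 0) +
      (if (zeroSet c).card = 4 then f 4 else 0) := by
    intro c hc
    rw [Finset.mem_filter] at hc
    by_cases h0 : c = 0
    · subst h0
      rw [zeroSet_zero_card, if_pos rfl, if_neg (by omega), if_neg (by omega),
        if_neg (by omega), if_neg (by omega)]
      rfl
    · rcases h.card_zeroSet_cases hc.2 h0 with e | e | e | e <;> simp [e, h0]
  have h2 : ∀ i, i ≤ n → (∑ c : Fin n → F with c ∈ D, if (zeroSet c).card = i then f i else 0) =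
      weightCount D (n - i) * f i := by
    intro i hi
    rw [← Finset.sum_filter, Finset.sum_const, Finset.filter_filter, weightCount_sub hi,
      smul_eq_mul]
  rw [Finset.sum_congr rfl h1]
  simp only [Finset.sum_add_distrib]
  rw [h2 0 (by omega), h2 1 (by omega), h2 2 (by omega), h2 4 (by omega),
    Finset.sum_ite_eq', if_pos (by simp), Nat.sub_zero]

theorem weightCount_eq_zero {w : ℕ} (hw : ∀ i, i = 0 ∨ i = 1 ∨ i = 2 ∨ i = 4 ∨ i = n → w + i ≠ n) :
    weightCount D w = 0 := by
  rw [weightCount]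
  convert Set.ncard_empty (Fin n → F)
  refine Set.eq_empty_iff_forall_notMem.2 ?_
  rintro c ⟨hc, rfl⟩
  have := card_zeroSet_add_hammingNorm c
  by_cases h0 : c = 0
  · subst h0
    exact hw n (by simp) (by simp)
  · have := h.card_zeroSet_cases hc h0
    exact hw (zeroSet c).card (by tauto) (by omega)

omit h in
theorem weightCount_zero : weightCount D 0 = 1 := by
  rw [weightCount, Set.ncard_eq_one]
  refine ⟨0, Set.ext fun c => ?_⟩
  simp only [Set.mem_ofPred_eq, hammingNorm_eq_zero, Set.mem_singleton_iff]
  exact ⟨fun h => h.2, fun h => ⟨h ▸ D.zero_mem, h⟩⟩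

theorem weightEnumerator_eq_sum : weightEnumerator D =
    1 + Polynomial.C (weightCount D (n - 4) : ℚ) * X ^ (n - 4)
      + Polynomial.C (weightCount D (n - 2) : ℚ) * X ^ (n - 2)
      + Polynomial.C (weightCount D (n - 1) : ℚ) * X ^ (n - 1)
      + Polynomial.C (weightCount D n : ℚ) * X ^ n := by
  obtain ⟨r, hr⟩ : ∃ r, n = r + 1 + 4 := ⟨n - 5, by have := h.five_le; omega⟩
  subst hr
  have e1 : r + 1 + 4 - 4 = r + 1 := by omega
  have e2 : r + 1 + 4 - 2 = r + 1 + 2 := by omega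
  have e3 : r + 1 + 4 - 1 = r + 1 + 3 := by omega
  have hr0 : ∑ w ∈ Finset.range (r + 1), Polynomial.C (weightCount D w : ℚ) * X ^ w = 1 := by
    rw [Finset.sum_eq_single 0]
    · simp [weightCount_zero]
    · intro w hw hw0
      rw [Finset.mem_range] at hw
      rw [h.weightCount_eq_zero (by omega)]
      simp
    · simp
  -- This is weight `n - 3`: no nonzero word has exactly three zeros.
  have h3 : weightCount D (r + 1 + 1) = 0 := h.weightCount_eq_zero (by omega)
  rw [weightEnumerator, show r + 1 + 4 + 1 = r + 1 + 1 + 1 + 1 + 1 + 1 by omega]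
  simp only [Finset.sum_range_succ _ (r + 1 + 1 + 1 + 1 + 1),
    Finset.sum_range_succ _ (r + 1 + 1 + 1 + 1), Finset.sum_range_succ _ (r + 1 + 1 + 1),
    Finset.sum_range_succ _ (r + 1 + 1), Finset.sum_range_succ _ (r + 1)]
  rw [hr0, h3, e1, e2, e3]
  simp [add_assoc]

/-- The moments `j = 0, 1, 2, 3` form a triangular system in the four unknown counts, solved from `j
= 3` downwards. -/
theorem weightEnumerator_eq [Finite F] {q : ℕ} (hF : Nat.card F = q) (hq : n = q + 1) :
    weightEnumerator D =
      1 + Polynomial.C (((q : ℚ) - 1) ^ 2 * q * (q + 1) / 24) * X ^ (q - 3)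
        + Polynomial.C (((q : ℚ) - 1) * q * (q + 1) * (q + 3) / 4) * X ^ (q - 1)
        + Polynomial.C (((q : ℚ) ^ 2 - 1) * (q ^ 2 - q + 3) / 3) * X ^ q
        + Polynomial.C (3 * ((q : ℚ) - 1) ^ 2 * q * (q + 1) / 8) * X ^ (q + 1) := by
  have := Fintype.ofFinite F
  rw [Nat.card_eq_fintype_card] at hF
  have m : ∀ j ≤ 3, (n.choose j * q ^ (4 - j) : ℚ) =
      n.choose j + weightCount D n * (Nat.choose 0 j) + weightCount D (n - 1) * (Nat.choose 1 j) +
        weightCount D (n - 2) * (Nat.choose 2 j) + weightCount D (n - 4) * (Nat.choose 4 j) := by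
    intro j hj
    have e := h.sum_choose_card_zeroSet hj
    rw [h.sum_card_zeroSet (fun i => i.choose j), hF] at e
    exact_mod_cast e.symm
  have c2 : (2 * n.choose 2 : ℚ) = (q + 1) * q := by
    have := Nat.descFactorial_eq_factorial_mul_choose n 2
    simp only [hq, Nat.descFactorial, Nat.factorial] at this
    rw [hq]
    norm_num at this
    exact_mod_cast (by linarith : 2 * (q + 1).choose 2 = (q + 1) * q)
  have c3 : (6 * n.choose 3 : ℚ) = (q + 1) * q * (q - 1) := by
    have h1 : 1 ≤ q := by have := h.five_le; omega
    have := Nat.descFactorial_eq_factorial_mul_choose n 3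
    simp only [hq, Nat.descFactorial, Nat.factorial] at this
    norm_num at this
    rw [show q + 1 - 2 = q - 1 by omega] at this
    rw [hq, ← Nat.cast_one (R := ℚ), ← Nat.cast_sub h1]
    exact_mod_cast (by linarith : 6 * (q + 1).choose 3 = (q + 1) * q * (q - 1))
  have m0 := m 0 (by norm_num)
  have m1 := m 1 (by norm_num)
  have m2 := m 2 (by norm_num)
  have m3 := m 3 (by norm_num)
  have d1 : Nat.choose 4 2 = 6 := rfl
  have cn : (n : ℚ) = q + 1 := by rw [hq]; push_cast; ring
  simp [cn, d1, Nat.choose_eq_zero_of_lt] at m0 m1 m2 m3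
  have w4 : (weightCount D (n - 4) : ℚ) = ((q : ℚ) - 1) ^ 2 * q * (q + 1) / 24 := by
    linear_combination (-1 / 4) * m3 + (q - 1) / 24 * c3
  have w2 : (weightCount D (n - 2) : ℚ) = ((q : ℚ) - 1) * q * (q + 1) * (q + 3) / 4 := by
    linear_combination (-1) * m2 + (q ^ 2 - 1) / 2 * c2 - 6 * w4
  have w1 : (weightCount D (n - 1) : ℚ) = ((q : ℚ) ^ 2 - 1) * (q ^ 2 - q + 3) / 3 := by
    linear_combination (-1) * m1 - 2 * w2 - 4 * w4
  have w0 : (weightCount D n : ℚ) = 3 * ((q : ℚ) - 1) ^ 2 * q * (q + 1) / 8 := by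
    linear_combination (-1) * m0 - w1 - w2 - w4
  rw [h.weightEnumerator_eq_sum, w4, w2, w1, w0, hq]
  rfl

end IsQuadrupleCode

end QuadrupleCode

/-! ### Quartics without quadratic term in characteristic three -/

section Quartic

variable {K : Type*} [Field K]

theorem ne_of_mul_add_eq [CharP K 3] {x y z w : K} (hxy : x ≠ y) (hxz : x ≠ z)
    (hw : w * (x + y + z) = -(x * y + x * z + y * z)) : w ≠ x := by
  rintro rfl
  have h3 : (3 : K) = 0 := by exact_mod_cast CharP.cast_eq_zero K 3
  -- With `w = x` the relation becomes `(x - y) (x - z) = 0` modulo 3.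
  exact mul_ne_zero (sub_ne_zero.2 hxy) (sub_ne_zero.2 hxz)
    (by linear_combination hw - (w * y + w * z) * h3)

theorem quartic_eq_prod {x y z w a b a' b' : K} (hxy : x ≠ y) (hxz : x ≠ z) (hyz : y ≠ z)
    (h1 : x + y + z ≠ 0) (hw : w * (x + y + z) = -(x * y + x * z + y * z))
    (hx : b * x ^ 4 + a * x ^ 3 + a' * x + b' = 0)
    (hy : b * y ^ 4 + a * y ^ 3 + a' * y + b' = 0)
    (hz : b * z ^ 4 + a * z ^ 3 + a' * z + b' = 0) :
    a = -b * (x + y + z + w) ∧ ∀ u, b * u ^ 4 + a * u ^ 3 + a' * u + b' =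
      b * ((u - x) * (u - y) * (u - z) * (u - w)) := by
  -- Divided differences: the first eliminate `b'`, the second eliminates `a'`.
  have exy : b * (x ^ 3 + x ^ 2 * y + x * y ^ 2 + y ^ 3) + a * (x ^ 2 + x * y + y ^ 2) + a' = 0 :=
    mul_left_cancel₀ (sub_ne_zero.2 hxy) (by linear_combination hx - hy)
  have exz : b * (x ^ 3 + x ^ 2 * z + x * z ^ 2 + z ^ 3) + a * (x ^ 2 + x * z + z ^ 2) + a' = 0 :=
    mul_left_cancel₀ (sub_ne_zero.2 hxz) (by linear_combination hx - hz)
  have e : b * ((x + y + z) ^ 2 - (x * y + x * z + y * z)) + a * (x + y + z) = 0 :=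
    mul_left_cancel₀ (sub_ne_zero.2 hyz) (by linear_combination exy - exz)
  have ha : a = -b * (x + y + z + w) :=
    mul_left_cancel₀ h1 (by linear_combination e + b * hw)
  refine ⟨ha, fun u => ?_⟩
  have ha' : a' = -(b * (x ^ 3 + x ^ 2 * y + x * y ^ 2 + y ^ 3) + a * (x ^ 2 + x * y + y ^ 2)) := by
    linear_combination exy
  have hb' : b' = -(b * x ^ 4 + a * x ^ 3 + a' * x) := by linear_combination hx
  rw [hb', ha', ha]
  linear_combination (-b) * (u - x) * (u - y) * hw

/-- The Frobenius power inverts `x, y, z`, so `x+y+z = 0` would also give `xy+xz+yz = 0`, and then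
`(x-y)(x-z) = 3x^2 = 0`. -/
theorem add_add_ne_zero_of_norm_one [CharP K 3] {s : ℕ} {x y z : K} (hxy : x ≠ y) (hxz : x ≠ z)
    (hx : x * x ^ 3 ^ s = 1) (hy : y * y ^ 3 ^ s = 1) (hz : z * z ^ 3 ^ s = 1) :
    x + y + z ≠ 0 := by
  intro h
  have : Fact (Nat.Prime 3) := ⟨Nat.prime_three⟩
  have h3 : (3 : K) = 0 := by exact_mod_cast CharP.cast_eq_zero K 3
  have hq : x ^ 3 ^ s + y ^ 3 ^ s + z ^ 3 ^ s = 0 := by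
    rw [← add_pow_char_pow, ← add_pow_char_pow, h, zero_pow (by positivity)]
  have h2 : x * y + x * z + y * z = 0 := by
    linear_combination (x * y * z) * hq - y * z * hx - x * z * hy - x * y * hz
  exact mul_ne_zero (sub_ne_zero.2 hxy) (sub_ne_zero.2 hxz)
    (by linear_combination h2 - 2 * x * h + x ^ 2 * h3)

/-- Write `e₁ = x+y+z`, `e₂ = xy+xz+yz`. Conjugating `w e₁ = -e₂` gives `w^q e₂ = -e₁` with `q =
3^s`, so `w w^q e₁ = e₁`. -/
theorem norm_one_of_mul_eq [CharP K 3] {s : ℕ} {x y z w : K} (hxy : x ≠ y) (hxz : x ≠ z)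
    (hx : x * x ^ 3 ^ s = 1) (hy : y * y ^ 3 ^ s = 1) (hz : z * z ^ 3 ^ s = 1)
    (hw : w * (x + y + z) = -(x * y + x * z + y * z)) : w * w ^ 3 ^ s = 1 := by
  have : Fact (Nat.Prime 3) := ⟨Nat.prime_three⟩
  have h1 := add_add_ne_zero_of_norm_one hxy hxz hx hy hz
  have hodd : Odd (3 ^ s) := Odd.pow (by decide)
  have hq := congrArg (· ^ 3 ^ s) hw
  simp only [mul_pow, hodd.neg_pow, add_pow_char_pow] at hq
  have e : (x + y + z) * (w * w ^ 3 ^ s - 1) = 0 := by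
    have e1 : (x * y * z) * (x ^ 3 ^ s + y ^ 3 ^ s + z ^ 3 ^ s) = x * y + x * z + y * z := by
      linear_combination y * z * hx + x * z * hy + x * y * hz
    have e2 : (x * y * z) * (x ^ 3 ^ s * y ^ 3 ^ s + x ^ 3 ^ s * z ^ 3 ^ s + y ^ 3 ^ s * z ^ 3 ^ s) =
        x + y + z := by
      linear_combination z * (y * y ^ 3 ^ s) * hx + z * hy + y * (z * z ^ 3 ^ s) * hx + y * hz +
        x * (z * z ^ 3 ^ s) * hy + x * hz
    linear_combination w ^ 3 ^ s * hw - (x * y * z) * hq + w ^ 3 ^ s * e1 + e2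
  exact sub_eq_zero.1 ((mul_eq_zero.1 e).resolve_left h1)

end Quartic

/-! ### The trace code of `a x + b x ^ 2` on the roots of unity of order `q + 1` -/

section TraceCode

variable (F : Type*) [Field F] {K : Type*} [Field K] [Algebra F K]

/-- The word `(Tr (a β ^ i + b β ^ (2 i)))_i` of length `n`. -/
noncomputable def traceWord (n : ℕ) (β : K) : K × K →ₗ[F] (Fin n → F) where
  toFun p i := Algebra.trace F K (p.1 * β ^ (i : ℕ) + p.2 * (β ^ 2) ^ (i : ℕ))
  map_add' p r := by
    ext i
    simp only [Prod.fst_add, Prod.snd_add, Pi.add_apply, ← map_add]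
    congr 1
    ring
  map_smul' t p := by
    ext i
    simp only [Prod.smul_fst, Prod.smul_snd, Pi.smul_apply, RingHom.id_apply, ← map_smul,
      smul_add, smul_mul_assoc]

/-- The code of all trace words. -/
noncomputable def traceCode (n : ℕ) (β : K) : Submodule F (Fin n → F) :=
  LinearMap.range (traceWord F n β)

/-- Delsarte duality: `a` and `b` vary independently and the trace form is nondegenerate. -/
theorem mem_dualCode_traceCode [Finite F] [Finite K] {n : ℕ} {β : K} {c : Fin n → F} :
    c ∈ dualCode (traceCode F n β) ↔ (∑ i, algebraMap F K (c i) * β ^ (i : ℕ) = 0) ∧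
      ∑ i, algebraMap F K (c i) * (β ^ 2) ^ (i : ℕ) = 0 := by
  have key : ∀ a b : K, traceWord F n β (a, b) ⬝ᵥ c = Algebra.trace F K
      (a * (∑ i, algebraMap F K (c i) * β ^ (i : ℕ)) +
        b * ∑ i, algebraMap F K (c i) * (β ^ 2) ^ (i : ℕ)) := by
    intro a b
    rw [Finset.mul_sum, Finset.mul_sum, ← Finset.sum_add_distrib, map_sum]
    refine Finset.sum_congr rfl fun i _ => ?_
    change Algebra.trace F K (a * β ^ (i : ℕ) + b * (β ^ 2) ^ (i : ℕ)) * c i = _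
    rw [mul_comm, ← smul_eq_mul, ← map_smul, Algebra.smul_def]
    congr 1
    ring
  have hnd : ∀ y : K, (∀ a : K, Algebra.trace F K (a * y) = 0) → y = 0 := fun y hy =>
    (traceForm_nondegenerate F K).2 y hy
  rw [mem_dualCode]
  constructor
  · intro h
    constructor
    · refine hnd _ fun a => ?_
      have := h _ ⟨(a, 0), rfl⟩
      rwa [key, zero_mul, add_zero] at this
    · refine hnd _ fun b => ?_
      have := h _ ⟨(0, b), rfl⟩
      rwa [key, zero_mul, zero_add] at this
  · rintro ⟨h1, h2⟩ _ ⟨⟨a, b⟩, rfl⟩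
    rw [key, h1, h2, mul_zero, mul_zero, add_zero, map_zero]

variable {F}

theorem traceWord_apply_eq_zero_iff [Finite F] [Finite K] {q : ℕ} (hF : Nat.card F = q)
    (hFK : Module.finrank F K = 2) {s : ℕ} (hq : q = 3 ^ s) [CharP K 3] {n : ℕ} {β a b : K}
    (hβ : β ^ (q + 1) = 1) (i : Fin n) :
    traceWord F n β (a, b) i = 0 ↔ b * (β ^ (i : ℕ)) ^ 4 + a * (β ^ (i : ℕ)) ^ 3 +
      a ^ q * (β ^ (i : ℕ)) + b ^ q = 0 := by
  have : Fact (Nat.Prime 3) := ⟨Nat.prime_three⟩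
  set x := β ^ (i : ℕ) with hx
  have hx1 : x * x ^ q = 1 := by rw [← pow_succ', hx, ← pow_mul, mul_comm, pow_mul, hβ, one_pow]
  have hx0 : x ≠ 0 := left_ne_zero_of_mul_eq_one hx1
  have e : algebraMap F K (traceWord F n β (a, b) i) =
      a * x + b * x ^ 2 + (a ^ q * x ^ q + b ^ q * (x ^ q) ^ 2) := by
    change algebraMap F K (Algebra.trace F K (a * x + b * (β ^ 2) ^ (i : ℕ))) = _
    rw [FiniteField.algebraMap_trace_eq_sum_pow, hFK, hF, Finset.sum_range_succ,
      Finset.sum_range_one, pow_zero, pow_one, pow_one, pow_right_comm β 2 i, ← hx]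
    congr 1
    rw [hq, add_pow_char_pow, mul_pow, mul_pow, pow_right_comm x 2]
  rw [← map_eq_zero (algebraMap F K), e, ← mul_right_inj' (pow_ne_zero 2 hx0), mul_zero]
  have e2 : x ^ 2 * (a * x + b * x ^ 2 + (a ^ q * x ^ q + b ^ q * (x ^ q) ^ 2)) =
      b * x ^ 4 + a * x ^ 3 + a ^ q * x + b ^ q := by
    linear_combination (a ^ q * x + b ^ q * (x * x ^ q + 1)) * hx1
  rw [e2]

theorem exists_zeroSet_traceWord [DecidableEq F] [Finite F] [Finite K] {q : ℕ}
    (hF : Nat.card F = q) (hFK : Module.finrank F K = 2) {s : ℕ} (hq : q = 3 ^ s) [CharP K 3]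
    {β : K} (hβ : IsPrimitiveRoot β (q + 1)) (T : Finset (Fin (q + 1))) (hT : T.card = 3) :
    ∃ B : Finset (Fin (q + 1)), T ⊆ B ∧ B.card = 4 ∧ ∀ p : K × K, p ≠ 0 →
      T ⊆ zeroSet (traceWord F (q + 1) β p) → zeroSet (traceWord F (q + 1) β p) = B := by
  obtain ⟨i, j, k, hij, hik, hjk, rfl⟩ := Finset.card_eq_three.1 hT
  have inj : ∀ i j : Fin (q + 1), i ≠ j → β ^ (i : ℕ) ≠ β ^ (j : ℕ) := fun i j hne e =>
    hne (Fin.ext (hβ.pow_inj i.2 j.2 e))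
  have nrm : ∀ i : Fin (q + 1), β ^ (i : ℕ) * (β ^ (i : ℕ)) ^ 3 ^ s = 1 := fun i => by
    rw [← pow_succ', ← hq, ← pow_mul, mul_comm, pow_mul, hβ.pow_eq_one, one_pow]
  have h1 := add_add_ne_zero_of_norm_one (inj i j hij) (inj i k hik) (nrm i) (nrm j) (nrm k)
  obtain ⟨w, hw⟩ : ∃ w : K, w * (β ^ (i : ℕ) + β ^ (j : ℕ) + β ^ (k : ℕ)) =
      -(β ^ (i : ℕ) * β ^ (j : ℕ) + β ^ (i : ℕ) * β ^ (k : ℕ) + β ^ (j : ℕ) * β ^ (k : ℕ)) :=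
    ⟨_, div_mul_cancel₀ _ h1⟩
  have hwn := norm_one_of_mul_eq (inj i j hij) (inj i k hik) (nrm i) (nrm j) (nrm k) hw
  rw [← pow_succ', ← hq] at hwn
  -- The fourth root is a power of `β`, hence a coordinate position.
  obtain ⟨l, hl, rfl⟩ := hβ.eq_pow_of_pow_eq_one hwn
  obtain ⟨l, rfl⟩ : ∃ l' : Fin (q + 1), (l' : ℕ) = l := ⟨⟨l, hl⟩, rfl⟩
  have hli : l ≠ i := fun e => ne_of_mul_add_eq (inj i j hij) (inj i k hik) hw
    (by rw [e])
  have hlj : l ≠ j := fun e => ne_of_mul_add_eq (inj j i hij.symm) (inj j k hjk)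
    (w := β ^ (l : ℕ)) (by linear_combination hw) (by rw [e])
  have hlk : l ≠ k := fun e => ne_of_mul_add_eq (inj k i hik.symm)
    (inj k j hjk.symm) (w := β ^ (l : ℕ)) (by linear_combination hw) (by rw [e])
  refine ⟨insert l {i, j, k}, Finset.subset_insert _ _, ?_, ?_⟩
  · rw [Finset.card_insert_of_notMem (by simp [hli, hlj, hlk]), hT]
  · rintro ⟨a, b⟩ hp hsub
    simp only [Finset.insert_subset_iff, Finset.singleton_subset_iff, mem_zeroSet,
      traceWord_apply_eq_zero_iff hF hFK hq hβ.pow_eq_one] at hsub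
    obtain ⟨hi, hj, hk⟩ := hsub
    obtain ⟨ha, hf⟩ := quartic_eq_prod (inj i j hij) (inj i k hik) (inj j k hjk) h1 hw hi hj hk
    have hb : b ≠ 0 := by
      rintro rfl
      exact hp (by rw [ha]; simp)
    ext m
    rw [mem_zeroSet, traceWord_apply_eq_zero_iff hF hFK hq hβ.pow_eq_one, hf]
    have inj' : ∀ i : Fin (q + 1), β ^ (m : ℕ) - β ^ (i : ℕ) = 0 ↔ m = i := fun i =>
      ⟨fun e => by_contra fun hne => inj m i hne (sub_eq_zero.1 e), fun e => by rw [e, sub_self]⟩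
    simp only [mul_eq_zero, hb, inj', false_or, Finset.mem_insert, Finset.mem_singleton]
    tauto

theorem isQuadrupleCode_traceCode [DecidableEq F] [Finite F] [Finite K] {q : ℕ}
    (hF : Nat.card F = q) (hFK : Module.finrank F K = 2) {s : ℕ} (hq : q = 3 ^ s) (hq4 : 4 ≤ q)
    [CharP K 3] {β : K} (hβ : IsPrimitiveRoot β (q + 1)) :
    IsQuadrupleCode (traceCode F (q + 1) β) where
  five_le := by omega
  finrank_eq := by
    -- A nonzero pair giving the zero word would have all `q + 1 > 4` positions as its zero set.
    -- Injectivity gives dimension `2 + 2`.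
    have hinj : Function.Injective (traceWord F (q + 1) β) := by
      refine (injective_iff_map_eq_zero _).2 fun p hp => by_contra fun h0 => ?_
      obtain ⟨T, -, hT⟩ := Finset.exists_subset_card_eq
        (s := (Finset.univ : Finset (Fin (q + 1)))) (n := 3) (by rw [Finset.card_fin]; omega)
      obtain ⟨B, -, hB, hu⟩ := exists_zeroSet_traceWord hF hFK hq hβ T hT
      have hz : zeroSet (traceWord F (q + 1) β p) = Finset.univ := by
        rw [hp]
        ext i
        simp [mem_zeroSet]
      have := hu p h0 (by rw [hz]; exact Finset.subset_univ T)
      rw [← this, hz, Finset.card_fin] at hB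
      omega
    have : Module.Finite F K := Module.finite_of_finrank_eq_succ hFK
    rw [traceCode, LinearMap.finrank_range_of_inj hinj, Module.finrank_prod, hFK]
  exists_zeroSet T hT := by
    obtain ⟨B, hTB, hB, hu⟩ := exists_zeroSet_traceWord hF hFK hq hβ T hT
    refine ⟨B, hTB, hB, ?_⟩
    rintro _ ⟨p, rfl⟩ h0 hTz
    exact hu p (fun e => h0 (by rw [e, map_zero])) hTz

end TraceCode

/-! ### Membership in cyclic and BCH codes -/

section CyclicCode

variable {F : Type*} [Field F] {n : ℕ}

theorem wordClass_eq_mk (c : Fin n → F) :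
    wordClass F n c = AdjoinRoot.mk (X ^ n - 1 : F[X]) (∑ i, Polynomial.C (c i) * X ^ (i : ℕ)) := by
  rw [wordClass, Fintype.linearCombination_apply, map_sum]
  refine Finset.sum_congr rfl fun i _ => ?_
  rw [map_mul, map_pow, AdjoinRoot.mk_X, AdjoinRoot.mk_C, Algebra.smul_def]
  rfl

/-- As `g` divides the modulus, divisibility by `g` does not depend on the chosen representative. -/
theorem mem_cyclicCode_iff {g : F[X]} (hg : g ∣ X ^ n - 1) {c : Fin n → F} :
    c ∈ cyclicCode F n g ↔ g ∣ ∑ i, Polynomial.C (c i) * X ^ (i : ℕ) := by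
  rw [cyclicCode, Submodule.mem_comap, Submodule.restrictScalars_mem, wordClass_eq_mk,
    Ideal.mem_span_singleton]
  constructor
  · rintro ⟨r, hr⟩
    obtain ⟨r, rfl⟩ := AdjoinRoot.mk_surjective r
    rw [← map_mul, AdjoinRoot.mk_eq_mk] at hr
    exact (dvd_sub_left (dvd_mul_right g r)).1 (hg.trans hr)
  · exact fun hd => map_dvd _ hd

variable [DecidableEq F] {K : Type*} [Field K] [Algebra F K]

theorem mem_bchCode_three_one_iff {α : K} (hβ : bchRoot F n α ^ n = 1) {c : Fin n → F} :
    c ∈ bchCode F n 3 1 α ↔ (∑ i, algebraMap F K (c i) * bchRoot F n α ^ (i : ℕ) = 0) ∧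
      ∑ i, algebraMap F K (c i) * (bchRoot F n α ^ 2) ^ (i : ℕ) = 0 := by
  set β := bchRoot F n α with hβdef
  have hdvd : ∀ p : F[X], bchGenerator F n 3 1 α ∣ p ↔ aeval β p = 0 ∧ aeval (β ^ 2) p = 0 := by
    intro p
    rw [bchGenerator, Finset.lcm_dvd_iff]
    simp only [← hβdef, ← minpoly.dvd_iff]
    constructor
    · intro h
      have h0 := h 0 (by simp)
      have h1 := h 1 (by simp)
      norm_num at h0 h1
      refine ⟨h0, ?_⟩
      exact_mod_cast h1
    · rintro ⟨h0, h1⟩ i hi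
      have hi : i < 2 := by simpa using hi
      interval_cases i
      · simpa using h0
      · norm_num
        exact_mod_cast h1
  have hg : bchGenerator F n 3 1 α ∣ X ^ n - 1 := by
    rw [hdvd]
    simp [hβ, pow_right_comm β 2 n]
  rw [bchCode, mem_cyclicCode_iff hg, hdvd]
  simp

end CyclicCode

/-! ### The order of `q` modulo `q + 1` and the primitive root `β` -/

section RootOfUnity

theorem orderOf_natCast_succ {q : ℕ} (hq : 2 ≤ q) : orderOf (q : ZMod (q + 1)) = 2 := by
  have : Fact (Nat.Prime 2) := ⟨Nat.prime_two⟩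
  -- Hence `q^2 = 1`, so `K` is the quadratic extension and `β = α^(q-1)`.
  have e : (q : ZMod (q + 1)) = -1 := by
    have := ZMod.natCast_self (q + 1)
    push_cast at this
    exact eq_neg_of_add_eq_zero_left this
  refine orderOf_eq_prime (by rw [e]; norm_num) ?_
  intro h1
  have : ((q : ℕ) : ZMod (q + 1)) = ((1 : ℕ) : ZMod (q + 1)) := by rw [h1, Nat.cast_one]
  rw [ZMod.natCast_eq_natCast_iff', Nat.mod_eq_of_lt (by omega), Nat.mod_eq_of_lt (by omega)] at this
  omega

theorem isPrimitiveRoot_bchRoot {q : ℕ} (hq : 2 ≤ q) {F K : Type*} [Field F] [Field K] [Finite K]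
    [Algebra F K] (hF : Nat.card F = q) (hK : Nat.card K = q ^ 2) {α : Kˣ}
    (hα : ∀ x : Kˣ, x ∈ Subgroup.zpowers α) :
    IsPrimitiveRoot (bchRoot F (q + 1) (α : K)) (q + 1) := by
  have h1 : 1 ≤ q ^ 2 := Nat.one_le_pow _ _ (by omega)
  have ho : orderOf α = q ^ 2 - 1 := by
    rw [orderOf_eq_card_of_forall_mem_zpowers hα, Nat.card_units, hK]
  have hm : q ^ 2 - 1 = (q - 1) * (q + 1) := by
    obtain ⟨r, rfl⟩ : ∃ r, q = r + 1 := ⟨q - 1, by omega⟩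
    rw [Nat.add_sub_cancel, Nat.sub_eq_iff_eq_add (by nlinarith)]
    ring
  have hp : IsPrimitiveRoot (α : K) (q ^ 2 - 1) := by
    rw [IsPrimitiveRoot.coe_units_iff, ← ho]
    exact IsPrimitiveRoot.orderOf α
  rw [bchRoot, hF, orderOf_natCast_succ hq]
  refine hp.pow (by rw [hm]; exact Nat.mul_pos (by omega) (by omega)) ?_
  rw [hm, Nat.mul_div_cancel _ (by omega)]

end RootOfUnity

/-- The field `F` is `GF(q)` with `q = 3 ^ s`, the field `K` is `GF(q ^ m)` with `m` the
multiplicative order of `q` modulo the length `q + 1`, and `α` is a generator of the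
multiplicative group of `K`. -/
theorem mainTheorem1 (s : ℕ) (hs : 2 ≤ s) (q : ℕ) (hq : q = 3 ^ s)
    (F : Type*) [Field F] [Finite F] [DecidableEq F] (hF : Nat.card F = q)
    (K : Type*) [Field K] [Finite K] [Algebra F K]
    (hK : Nat.card K = q ^ orderOf (q : ZMod (q + 1)))
    (α : Kˣ) (hα : ∀ x : Kˣ, x ∈ Subgroup.zpowers α)
    (C : Submodule F (Fin (q + 1) → F)) (hC : C = bchCode F (q + 1) 3 1 (α : K)) :
    HasParameters C (q - 3) 4 ∧
    HasParameters (dualCode C) 4 (q - 3) ∧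
    IsNMDS C ∧
    IsNMDS (dualCode C) ∧
    weightEnumerator (dualCode C) =
      1 + Polynomial.C (((q : ℚ) - 1) ^ 2 * q * (q + 1) / 24) * X ^ (q - 3)
        + Polynomial.C (((q : ℚ) - 1) * q * (q + 1) * (q + 3) / 4) * X ^ (q - 1)
        + Polynomial.C (((q : ℚ) ^ 2 - 1) * (q ^ 2 - q + 3) / 3) * X ^ q
        + Polynomial.C (3 * ((q : ℚ) - 1) ^ 2 * q * (q + 1) / 8) * X ^ (q + 1) ∧
    (∃ l : ℕ, (l : ℚ) = ((q : ℚ) - 3) * (q - 4) * (q - 5) / 24 ∧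
      IsDesign (supportBlocks (dualCode C) (q - 3)) 3 (q + 1) (q - 3) l) ∧
    IsDesign (supportBlocks C 4) 3 (q + 1) 4 1 ∧
    IsSteinerSystem (supportBlocks C 4) 3 4 (3 ^ s + 1) ∧
    (∃ l : ℕ, (l : ℚ) = ((q : ℚ) - 3) * (q - 7) / 2 ∧
      IsDesign (supportBlocks C 5) 3 (q + 1) 5 l) := by
  have : Fact (Nat.Prime 3) := ⟨Nat.prime_three⟩
  have hq9 : 9 ≤ q := by
    rw [hq]
    exact Nat.pow_le_pow_right (n := 3) (by norm_num) hs
  rw [orderOf_natCast_succ (by omega)] at hK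
  have := Fintype.ofFinite K
  have hchar : CharP K 3 := charP_of_card_eq_prime_pow (f := 2 * s)
    (by rw [← Nat.card_eq_fintype_card, hK, hq, ← pow_mul, mul_comm])
  have hFK : Module.finrank F K = 2 := by
    have e := Module.natCard_eq_pow_finrank (K := F) (V := K)
    rw [hK, hF] at e
    exact (Nat.pow_right_injective (by omega) e).symm
  have hβ := isPrimitiveRoot_bchRoot (F := F) (by omega) hF hK hα
  set D := traceCode F (q + 1) (bchRoot F (q + 1) (α : K))
  have hD : IsQuadrupleCode D := isQuadrupleCode_traceCode hF hFK hq (by omega) hβ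
  -- Both sides are cut out by the vanishing of the word polynomial at `β` and `β^2`.
  have hCD : C = dualCode D := by
    ext c
    rw [hC, mem_bchCode_three_one_iff hβ.pow_eq_one, mem_dualCode_traceCode]
  have hDC : dualCode C = D := by rw [hCD, dualCode_dualCode]
  have e4 : q + 1 - 4 = q - 3 := by omega
  rw [hDC, hCD]
  refine ⟨e4 ▸ hD.hasParameters_dual, e4 ▸ hD.hasParameters,
    ⟨hD.isAMDS_dual, (dualCode_dualCode D).symm ▸ hD.isAMDS⟩, ⟨hD.isAMDS, hD.isAMDS_dual⟩,
    hD.weightEnumerator_eq hF rfl, ?_, hD.isDesign_dual_four,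
    ⟨by norm_num, hq ▸ hD.isDesign_dual_four⟩, ?_⟩
  · obtain ⟨l, hl, hdes⟩ := hD.isDesign_sub_four (by omega)
    refine ⟨l, ?_, e4 ▸ hdes⟩
    have hl' : (24 * l : ℚ) = (((q + 1 : ℕ) : ℚ) - 4) * (((q + 1 : ℕ) : ℚ) - 5) *
        (((q + 1 : ℕ) : ℚ) - 6) := by exact_mod_cast hl
    push_cast at hl'
    linear_combination hl' / 24
  · obtain ⟨l, hl, hdes⟩ := hD.isDesign_dual_five
    refine ⟨l, ?_, hdes⟩
    have hl' : (2 * l : ℚ) = ((q + 1 - 4 : ℕ) : ℚ) * ((q + 1 - 8 : ℕ) : ℚ) := by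
      exact_mod_cast hl
    rw [Nat.cast_sub (by omega), Nat.cast_sub (by omega)] at hl'
    push_cast at hl'
    linear_combination hl' / 2
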